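/- Let $\gamma$ be a plane oval, that is, a simple closed smooth regular plane curve with nowhere vanishing curvature, and suppose that its curvature has only finitely many critical points. Orient $\gamma$ so that its signed curvature is negative, and let $\beta$ be its evolute, i.e. the envelope of the normal lines of $\gamma$, parametrized by the parameter of $\gamma$. Then $\beta$ is a smooth closed parametrized curve with isolated singular points. It has the standard orientation: near each regular point the curve lies to the right of its oriented tangent line there. A cusp of $\beta$ is a parameter value (within one period) at which the tangent direction of $\beta$ is reversed, and a vertex of $\gamma$ is a parameter value at which the curvature of $\gamma$ has a local extremum. The cusps of $\beta$ occur exactly at the vertices of $\gamma$, and their number $n$ is finite. The rotation index $i$ of $\beta$ is defined as follows: in one circuit of $\beta$ the tangent vector turns anticlockwise through the total angle $2\pi i$, where its angle varies continuously away from the cusps and jumps by $+\pi$ at each cusp. Then $i$ is a well-defined integer and $$ i=\frac{n-2}{2}. $$ -/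

import Mathlib

open Filter Topology Set
open scoped ContDiff ComplexConjugate

noncomputable section

/-- Signed curvature of a parametrized curve in the Euclidean plane, identified with `ℂ`;
`(conj v * w).im` is the determinant of the pair `(v, w)`. -/
def signedCurvature (γ : ℝ → ℂ) (t : ℝ) : ℝ :=
  (conj (deriv γ t) * deriv (deriv γ) t).im / ‖deriv γ t‖ ^ 3

/-- A plane oval, given by a regular smooth parametrization of period `L`: a simple closed
smooth curve which is strictly convex in the sense that its curvature does not vanish. -/
structure IsPlaneOval (γ : ℝ → ℂ) (L : ℝ) : Prop where
  period_pos : 0 < L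
  smooth : ContDiff ℝ ∞ γ
  closed : Function.Periodic γ L
  regular : ∀ t, deriv γ t ≠ 0
  simple : InjOn γ (Ico 0 L)
  strictlyConvex : ∀ t, signedCurvature γ t ≠ 0

/-- A vertex of a plane curve: a local extremum of its curvature. -/
def IsVertex (γ : ℝ → ℂ) (t : ℝ) : Prop :=
  IsLocalExtr (signedCurvature γ) t

/-- The inner product of `x - γ t` with the tangent vector at `γ t`. As a function of `x`, it
vanishes exactly on the normal line to the curve at `γ t`. -/
def normalLineEq (γ : ℝ → ℂ) (t : ℝ) (x : ℂ) : ℝ :=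
  (conj (deriv γ t) * (x - γ t)).re

/-- `β` is the evolute of `γ`, parametrized by the parameter of `γ`: the envelope of the
family of normal lines, `F (t, x) = 0` and `∂F/∂t (t, x) = 0` at `x = β t`. -/
def IsEvolute (γ β : ℝ → ℂ) : Prop :=
  ∀ t, normalLineEq γ t (β t) = 0 ∧ deriv (fun s => normalLineEq γ s (β t)) t = 0

/-- The unit tangent vector (zero at singular points). -/
def unitTangent (β : ℝ → ℂ) (t : ℝ) : ℂ :=
  deriv β t / (‖deriv β t‖ : ℂ)

/-- The curve has a cusp at parameter `t`: its tangent direction is reversed there. -/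
def IsCurveCusp (β : ℝ → ℂ) (t : ℝ) : Prop :=
  ∃ v : ℂ, v ≠ 0 ∧ Tendsto (unitTangent β) (𝓝[<] t) (𝓝 v) ∧
    Tendsto (unitTangent β) (𝓝[>] t) (𝓝 (-v))

/-- The standard orientation: near each regular point the curve lies strictly to the right of
its oriented tangent line there (apart from the point itself), so the tangent line is to the
left of the curve. -/
def IsStandardlyOriented (β : ℝ → ℂ) : Prop :=
  ∀ t, deriv β t ≠ 0 → ∀ᶠ s in 𝓝[≠] t, (conj (deriv β t) * (β s - β t)).im < 0

/-- `φ` is the angle between a fixed direction and the unit tangent vector, varying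
continuously except that the tangent vector rotates by `+π` at each cusp. -/
structure IsTangentAngle (β : ℝ → ℂ) (φ : ℝ → ℝ) : Prop where
  angle : ∀ t, deriv β t ≠ 0 → unitTangent β t = Complex.exp (φ t * Complex.I)
  continuousAt : ∀ t, ¬ IsCurveCusp β t → ContinuousAt φ t
  jump : ∀ t, IsCurveCusp β t → ∃ a : ℝ,
    Tendsto φ (𝓝[<] t) (𝓝 a) ∧ Tendsto φ (𝓝[>] t) (𝓝 (a + Real.pi))

/-- The smooth closed curve `β` of period `L`, with isolated singular points, has rotation
index `i`: in one circuit its tangent vector turns anticlockwise through `2 * π * i`,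
each cusp contributing `+π`. -/
structure HasRotationIndex (β : ℝ → ℂ) (L : ℝ) (i : ℤ) : Prop where
  period_pos : 0 < L
  smooth : ContDiff ℝ ∞ β
  closed : Function.Periodic β L
  isolated : ∀ t, ∀ᶠ s in 𝓝[≠] t, deriv β s ≠ 0
  turning : ∃ φ : ℝ → ℝ, IsTangentAngle β φ ∧
    ∀ t, deriv β t ≠ 0 → φ (t + L) - φ t = 2 * Real.pi * i

end

/-! Write `γ' = |γ'| exp(iθ)` with `θ` differentiable, so that `θ' = κ |γ'| < 0`. Solving the
envelope equations gives the centre of curvature `β = γ + i exp(iθ) / κ`. On differentiating, the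
tangential terms cancel, leaving `β' = μ · i exp(iθ)` with `μ = -κ' / κ²`. Everything follows from
this formula (`IsEvolute.deriv_eq`).

The line spanned by the frame vector `i exp(iθ)` turns continuously and always clockwise. The
direction of `β` therefore reverses exactly where `κ'` changes sign; as the zeros of `κ'` are
isolated, these are the local extrema of `κ`. Monotonicity of `θ` also puts `β` to the right of its
tangents.

A tangent angle of `β` is `θ + π/2` plus `π` times the number of cusps passed, up to a constant
multiple of `π` (`exists_isTangentAngle`). Over one period `θ` changes by `-2π`, by Hopf's theorem
on turning tangents, and the cusps contribute `nπ`; the total is `2π (n - 2) / 2`. The number `n` is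
even because the periodic function `μ` changes sign an even number of times per period. Uniqueness
of the index holds because two tangent angles differ by a multiple of `2π` that cannot change, their
jumps at cusps being equal (`IsTangentAngle.exists_sub_eq`).

Hopf's theorem is proved with chords: the tangent direction is deformed, through directions of
chords of the simple curve, into two half turns seen from a lowest point. -/

/-! ### Continuous angles -/

/-- A continuous real function whose values all have the same image on the circle, is
constant. -/
theorem eq_of_exp_mul_I_eq {f : ℝ → ℝ} (hf : Continuous f) {z : ℂ}
    (h : ∀ s, Complex.exp (f s * Complex.I) = z) (s t : ℝ) : f s = f t := by
  refine Circle.isCoveringMap_exp.const_of_comp hf (fun a b => ?_) s t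
  ext
  simp [Circle.coe_exp, h]

/-- A nonvanishing continuous function on the plane has a continuous argument. -/
theorem exists_continuous_angle {G : ℝ × ℝ → ℂ} (hG : Continuous G) (h0 : ∀ p, G p ≠ 0) :
    ∃ α : ℝ × ℝ → ℝ, Continuous α ∧ ∀ p, G p = ‖G p‖ * Complex.exp (α p * Complex.I) := by
  let g : C(ℝ × ℝ, Circle) := ⟨fun p => ⟨G p / (‖G p‖ : ℂ), by
    simp [Submonoid.unitSphere, h0 p]⟩, by
    refine Continuous.subtype_mk ?_ _
    refine hG.div (by fun_prop) fun p => by simpa using h0 p⟩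
  obtain ⟨F, ⟨-, hF⟩, -⟩ := Circle.isCoveringMap_exp.existsUnique_continuousMap_lifts g (0, 0)
    (Complex.arg (g (0, 0))) (Circle.exp_arg _)
  refine ⟨F, F.continuous, fun p => ?_⟩
  have h1 : ((Circle.exp (F p) : Circle) : ℂ) = G p / ‖G p‖ :=
    congrArg Subtype.val (congrFun hF p)
  rw [← Circle.coe_exp, h1, mul_div_cancel₀]
  simpa using h0 p

/-- A continuous angle which stays in the closed upper half plane and joins two opposite
points changes by `π`. -/
theorem abs_angle_sub_eq_pi {α : ℝ → ℝ} (hα : Continuous α)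
    (him : ∀ u, 0 ≤ (Complex.exp (α u * Complex.I)).im) {a b : ℝ}
    (hab : Complex.exp (α b * Complex.I) = -Complex.exp (α a * Complex.I)) :
    |α b - α a| = Real.pi := by
  -- Multiplication by `-I` turns the closed upper half plane into the closed right half plane,
  -- which away from `0` avoids the branch cut of `arg`.
  have hne : ∀ u, -Complex.I * Complex.exp (α u * Complex.I) ∈ Complex.slitPlane := by
    intro u
    rw [Complex.mem_slitPlane_iff]
    by_contra! hcon
    obtain ⟨h1, h2⟩ := hcon
    have h3 := him u
    have h4 := Complex.exp_ne_zero (α u * Complex.I)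
    apply h4
    simp only [neg_mul, Complex.neg_re, Complex.neg_im, Complex.I_mul_re, Complex.I_mul_im,
      neg_neg] at h1 h2
    apply Complex.ext
    · simpa using h2
    · simpa using le_antisymm h1 h3
  -- Thus `α` agrees with a principal argument up to a constant, and its change can be read off from
  -- the values of `arg` at the two ends.
  have hc : Continuous fun u => α u - Complex.arg (-Complex.I * Complex.exp (α u * Complex.I)) := by
    refine hα.sub ?_
    rw [continuous_iff_continuousAt]
    intro u
    exact ContinuousAt.comp (f := fun u => -Complex.I * Complex.exp (α u * Complex.I))
      (Complex.continuousAt_arg (hne u)) (by fun_prop)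
  have hconst := eq_of_exp_mul_I_eq hc (z := Complex.I) (fun u => by
    have h1 := Complex.norm_mul_exp_arg_mul_I (-Complex.I * Complex.exp (α u * Complex.I))
    simp only [norm_mul, norm_neg, Complex.norm_I, Complex.norm_exp_ofReal_mul_I, mul_one,
      Complex.ofReal_one, one_mul] at h1
    push_cast
    rw [sub_mul, Complex.exp_sub, h1]
    field_simp [Complex.exp_ne_zero]
    simp) b a
  -- Opposite points both in the closed upper half plane lie on the real axis, so they are `1` and
  -- `-1`.
  have hz : (Complex.exp (α a * Complex.I)).im = 0 := by
    have h1 := him a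
    have h2 := him b
    rw [hab, Complex.neg_im] at h2
    linarith
  have hn : ‖Complex.exp (α a * Complex.I)‖ = 1 := Complex.norm_exp_ofReal_mul_I _
  have hcases : Complex.exp (α a * Complex.I) = 1 ∨ Complex.exp (α a * Complex.I) = -1 := by
    have h1 : (Complex.exp (α a * Complex.I)).re * (Complex.exp (α a * Complex.I)).re = 1 := by
      have := Complex.normSq_eq_norm_sq (Complex.exp (α a * Complex.I))
      rw [hn, Complex.normSq_apply, hz] at this
      linarith
    rcases mul_self_eq_one_iff.mp h1 with h | h
    · left; exact Complex.ext (by simpa using h) (by simpa using hz)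
    · right; exact Complex.ext (by simpa using h) (by simpa using hz)
  have hpi := Real.pi_pos
  rw [hab] at hconst
  rcases hcases with h | h <;> rw [h] at hconst <;>
    simp only [neg_neg, mul_one, mul_neg, Complex.arg_I, Complex.arg_neg_I] at hconst
  · rw [show α b - α a = Real.pi by linarith]
    exact abs_of_pos hpi
  · rw [show α b - α a = -Real.pi by linarith, abs_neg]
    exact abs_of_pos hpi

/-! ### Chords and Hopf's theorem on turning tangents -/

/-- The mean velocity of a curve on `[s, s + u]`. -/
noncomputable def meanVelocity (γ : ℝ → ℂ) (s u : ℝ) : ℂ :=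
  ∫ τ in (0 : ℝ)..1, deriv γ (s + u * τ)

theorem continuous_meanVelocity {γ : ℝ → ℂ} (h : Continuous (deriv γ)) :
    Continuous fun p : ℝ × ℝ => meanVelocity γ p.1 p.2 := by
  unfold meanVelocity
  exact intervalIntegral.continuous_parametric_intervalIntegral_of_continuous' (by fun_prop) 0 1

theorem mul_meanVelocity {γ : ℝ → ℂ} (hd : Differentiable ℝ γ) (h : Continuous (deriv γ))
    (s u : ℝ) : u * meanVelocity γ s u = γ (s + u) - γ s := by
  have h1 := intervalIntegral.smul_integral_comp_add_mul (a := 0) (b := 1) (deriv γ) u s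
  rw [mul_zero, add_zero, mul_one,
    intervalIntegral.integral_deriv_eq_sub (fun x _ => hd x) (h.intervalIntegrable _ _)] at h1
  rw [← h1, meanVelocity, Complex.real_smul]

/-- The chord direction of a curve of period `L`: a positive multiple of
`γ (s + u) - γ s` for `0 < u < L`, extended continuously to all `u`. -/
noncomputable def chordDirection (γ : ℝ → ℂ) (L s u : ℝ) : ℂ :=
  meanVelocity γ s u - meanVelocity γ (s + L) (u - L)

/-- The two mean velocities are those of the arc forward from `γ s` and of the arc backward to the
same endpoint; the factor is `1 / u + 1 / (L - u)`. -/
theorem chordDirection_eq {γ : ℝ → ℂ} {L : ℝ} (hd : Differentiable ℝ γ)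
    (h : Continuous (deriv γ)) (hp : Function.Periodic γ L) {s u : ℝ} (hu : 0 < u) (huL : u < L) :
    chordDirection γ L s u = ((L / (u * (L - u)) : ℝ) : ℂ) * (γ (s + u) - γ s) := by
  have h1 := mul_meanVelocity hd h s u
  have h2 := mul_meanVelocity hd h (s + L) (u - L)
  rw [show s + L + (u - L) = s + u by ring, hp s] at h2
  have hu0 : (u : ℂ) ≠ 0 := by exact_mod_cast hu.ne'
  have hu1 : ((L : ℂ) - u) ≠ 0 := by exact_mod_cast (sub_pos.mpr huL).ne'
  have e1 : meanVelocity γ s u = (γ (s + u) - γ s) / u := by rw [← h1]; field_simp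
  have e2 : meanVelocity γ (s + L) (u - L) = -((γ (s + u) - γ s) / (L - u)) := by
    rw [← h2]; push_cast; field_simp; ring
  rw [chordDirection, e1, e2]
  push_cast
  field_simp
  ring

/-- At either end of `0 ≤ u ≤ L` one of the two mean velocities is taken over a full period and
vanishes, as the curve closes up. The other degenerates to the velocity, with opposite signs at the
two ends. -/
theorem chordDirection_zero {γ : ℝ → ℂ} {L : ℝ} (hL : L ≠ 0) (hd : Differentiable ℝ γ)
    (h : Continuous (deriv γ)) (hp : Function.Periodic γ L) (s : ℝ) :
    chordDirection γ L s 0 = deriv γ s := by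
  have h2 := mul_meanVelocity hd h (s + L) (0 - L)
  rw [show s + L + (0 - L) = s by ring, hp s, sub_self] at h2
  have : meanVelocity γ (s + L) (0 - L) = 0 := by
    rcases mul_eq_zero.mp h2 with h | h
    · simp [hL] at h
    · exact h
  rw [chordDirection, this]
  simp [meanVelocity]

theorem Function.Periodic.deriv_periodic {γ : ℝ → ℂ} {L : ℝ} (hp : Function.Periodic γ L) :
    Function.Periodic (deriv γ) L := by
  intro t
  rw [← deriv_comp_add_const]
  congr 1
  exact funext hp

theorem chordDirection_period {γ : ℝ → ℂ} {L : ℝ} (hL : L ≠ 0) (hd : Differentiable ℝ γ)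
    (h : Continuous (deriv γ)) (hp : Function.Periodic γ L) (s : ℝ) :
    chordDirection γ L s L = -deriv γ s := by
  have h2 := mul_meanVelocity hd h s L
  rw [hp s, sub_self] at h2
  have : meanVelocity γ s L = 0 := by
    rcases mul_eq_zero.mp h2 with h | h
    · simp [hL] at h
    · exact h
  rw [chordDirection, this]
  simp [meanVelocity, hp.deriv_periodic s]

/-- A closed curve which is injective on a period is injective modulo the period. -/
theorem Function.Periodic.apply_add_ne {γ : ℝ → ℂ} {L : ℝ} (hL : 0 < L)
    (hp : Function.Periodic γ L) (hs : InjOn γ (Ico 0 L)) {s u : ℝ} (hu : 0 < u) (huL : u < L) :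
    γ (s + u) ≠ γ s := by
  intro heq
  have key : ∀ x, γ (toIcoMod hL 0 x) = γ x := fun x => by
    rw [toIcoMod]; exact hp.sub_zsmul_eq _
  have hmem : ∀ x, toIcoMod hL 0 x ∈ Ico 0 L := fun x => by
    simpa using toIcoMod_mem_Ico hL 0 x
  have h1 := hs (hmem (s + u)) (hmem s) (by rw [key, key, heq])
  rw [toIcoMod_eq_toIcoMod] at h1
  obtain ⟨n, hn⟩ := h1
  rw [zsmul_eq_mul] at hn
  have h2 : (n : ℝ) * L < 0 := by linarith
  have h3 : -1 * L < (n : ℝ) * L := by linarith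
  have h4 : (n : ℝ) < 0 := by by_contra! hc; nlinarith
  have h5 : (-1 : ℝ) < n := lt_of_mul_lt_mul_right h3 hL.le
  have h6 : n < 0 := by exact_mod_cast h4
  have h7 : -1 < n := by exact_mod_cast h5
  omega

theorem chordDirection_ne_zero {γ : ℝ → ℂ} {L : ℝ} (hL : 0 < L) (hd : Differentiable ℝ γ)
    (h : Continuous (deriv γ)) (hp : Function.Periodic γ L) (hs : InjOn γ (Ico 0 L))
    (hreg : ∀ t, deriv γ t ≠ 0) {s u : ℝ} (hu : 0 ≤ u) (huL : u ≤ L) :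
    chordDirection γ L s u ≠ 0 := by
  rcases hu.eq_or_lt with rfl | hu
  · rw [chordDirection_zero hL.ne' hd h hp]; exact hreg s
  rcases huL.eq_or_lt with rfl | huL
  · rw [chordDirection_period hL.ne' hd h hp]; exact neg_ne_zero.mpr (hreg s)
  rw [chordDirection_eq hd h hp hu huL]
  have : 0 < L / (u * (L - u)) := div_pos hL (mul_pos hu (sub_pos.mpr huL))
  exact mul_ne_zero (by exact_mod_cast this.ne')
    (sub_ne_zero.mpr (hp.apply_add_ne hL hs hu huL))

/-- Going on by `L - u` from `γ (s + u)` leads back to `γ s`, so the same chord is traversed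
backwards; the positive factor is symmetric in `u` and `L - u`. -/
theorem chordDirection_reverse {γ : ℝ → ℂ} {L : ℝ} (hL : 0 < L) (hd : Differentiable ℝ γ)
    (h : Continuous (deriv γ)) (hp : Function.Periodic γ L) {s u : ℝ} (hu : 0 ≤ u) (huL : u ≤ L) :
    chordDirection γ L (s + u) (L - u) = -chordDirection γ L s u := by
  rcases hu.eq_or_lt with rfl | hu
  · rw [chordDirection_zero hL.ne' hd h hp, sub_zero, chordDirection_period hL.ne' hd h hp,
      add_zero]
  rcases huL.eq_or_lt with rfl | huL
  · rw [chordDirection_period hL.ne' hd h hp, sub_self, chordDirection_zero hL.ne' hd h hp,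
      hp.deriv_periodic, neg_neg]
  rw [chordDirection_eq hd h hp hu huL, chordDirection_eq hd h hp (by linarith) (by linarith),
    show s + u + (L - u) = s + L by ring, hp s, show L - (L - u) = u by ring, mul_comm u]
  ring

/-- Hopf's theorem on turning tangents: the tangent direction of a simple closed regular curve
turns through `2 * π`, up to sign, in one circuit. -/
theorem exists_abs_angle_period_sub_eq_two_pi {γ : ℝ → ℂ} {L : ℝ} (hL : 0 < L)
    (hd : Differentiable ℝ γ)
    (h : Continuous (deriv γ)) (hp : Function.Periodic γ L) (hs : InjOn γ (Ico 0 L))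
    (hreg : ∀ t, deriv γ t ≠ 0) {θ : ℝ → ℝ} (hθ : Continuous θ)
    (hθγ : ∀ t, deriv γ t = ‖deriv γ t‖ * Complex.exp (θ t * Complex.I)) :
    ∃ t, |θ (t + L) - θ t| = 2 * Real.pi := by
  -- A lowest point: every chord issuing from it points into the closed upper half plane, and the
  -- tangent there is horizontal.
  obtain ⟨a, ha⟩ : ∃ a, ∀ t, (γ a).im ≤ (γ t).im := by
    have hc : Continuous fun t => (γ t).im := Complex.continuous_im.comp hd.continuous
    obtain ⟨a, -, ha⟩ := isCompact_Icc.exists_isMinOn (nonempty_Icc.mpr hL.le) hc.continuousOn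
    refine ⟨a, fun t => ?_⟩
    have hmem : toIcoMod hL 0 t ∈ Icc 0 L :=
      Ico_subset_Icc_self (by simpa using toIcoMod_mem_Ico hL 0 t)
    have this : (γ a).im ≤ (γ (toIcoMod hL 0 t)).im := ha hmem
    rwa [show γ (toIcoMod hL 0 t) = γ t by
      rw [toIcoMod]; exact hp.sub_zsmul_eq _] at this
  have him0 : (deriv γ a).im = 0 := by
    have h1 : HasDerivAt (fun t => (γ t).im) (deriv γ a).im a :=
      Complex.imCLM.hasFDerivAt.comp_hasDerivAt a (hd a).hasDerivAt
    exact IsLocalMin.hasDerivAt_eq_zero (Eventually.of_forall ha) h1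
  -- Clamping to `[0, L]` makes the chord direction nonvanishing on the whole plane, which is simply
  -- connected, so that an angle exists globally.
  let c : ℝ → ℝ := fun u => max 0 (min u L)
  have hc : Continuous c := by fun_prop
  have hc0 : ∀ u, 0 ≤ c u := fun u => le_max_left _ _
  have hcL : ∀ u, c u ≤ L := fun u => max_le hL.le (min_le_right _ _)
  have hcid : ∀ u, 0 ≤ u → u ≤ L → c u = u := fun u h0 h1 => by simp [c, h0, h1]
  have him : ∀ u, 0 ≤ (chordDirection γ L a (c u)).im := by
    intro u
    rcases (hc0 u).eq_or_lt with h0 | h0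
    · rw [← h0, chordDirection_zero hL.ne' hd h hp, him0]
    rcases (hcL u).eq_or_lt with h1 | h1
    · rw [h1, chordDirection_period hL.ne' hd h hp, Complex.neg_im, him0, neg_zero]
    rw [chordDirection_eq hd h hp h0 h1, Complex.im_ofReal_mul, Complex.sub_im]
    exact mul_nonneg (div_pos hL (mul_pos h0 (sub_pos.mpr h1))).le (sub_nonneg.mpr (ha _))
  let G : ℝ × ℝ → ℂ := fun p => chordDirection γ L p.1 (c p.2)
  have hGc : Continuous G := by
    have h1 := continuous_meanVelocity h
    refine (h1.comp (g := fun p : ℝ × ℝ => meanVelocity γ p.1 p.2)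
      (f := fun p : ℝ × ℝ => (p.1, c p.2)) (by fun_prop)).sub
      (h1.comp (g := fun p : ℝ × ℝ => meanVelocity γ p.1 p.2)
      (f := fun p : ℝ × ℝ => (p.1 + L, c p.2 - L)) (by fun_prop))
  have hG0 : ∀ p, G p ≠ 0 := fun p =>
    chordDirection_ne_zero hL hd h hp hs hreg (hc0 _) (hcL _)
  obtain ⟨α, hαc, hα⟩ := exists_continuous_angle hGc hG0
  have hαexp : ∀ p, Complex.exp (α p * Complex.I) = G p / ‖G p‖ := fun p => by
    have : (‖G p‖ : ℂ) ≠ 0 := by simpa using hG0 p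
    rw [eq_div_iff this, mul_comm]; exact (hα p).symm
  have leg1 : |α (a, L) - α (a, 0)| = Real.pi := by
    refine abs_angle_sub_eq_pi (α := fun u => α (a, u)) (by fun_prop) (fun u => ?_) ?_
    · rw [hαexp, Complex.div_ofReal_im]
      exact div_nonneg (him u) (norm_nonneg _)
    · have e0 : G (a, 0) = deriv γ a := by
        simp only [G]; rw [hcid 0 le_rfl hL.le, chordDirection_zero hL.ne' hd h hp]
      have e1 : G (a, L) = -deriv γ a := by
        simp only [G]; rw [hcid L hL.le le_rfl, chordDirection_period hL.ne' hd h hp]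
      simp only [hαexp, e0, e1, norm_neg, neg_div]
  -- Along the second leg the chords are the negatives of those along the first, so the two angles
  -- differ by a constant; comparing the ends gives equal increments.
  have leg2 : α (a + L, 0) - α (a, L) = α (a, L) - α (a, 0) := by
    have hcont : Continuous fun u => α (a + c u, L - c u) - α (a, c u) := by fun_prop
    have hz := eq_of_exp_mul_I_eq hcont (z := -1) (fun u => by
      have e : G (a + c u, L - c u) = -G (a, c u) := by
        simp only [G]
        rw [hcid (L - c u) (by linarith [hcL u]) (by linarith [hc0 u]),
          hcid (c u) (hc0 u) (hcL u), chordDirection_reverse hL hd h hp (hc0 u) (hcL u)]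
      have hne : G (a, c u) / (‖G (a, c u)‖ : ℂ) ≠ 0 :=
        div_ne_zero (hG0 _) (by simpa using hG0 _)
      push_cast
      rw [sub_mul, Complex.exp_sub, hαexp, hαexp, e, norm_neg, neg_div, neg_div, div_self hne])
      L 0
    rw [hcid L hL.le le_rfl, hcid 0 le_rfl hL.le] at hz
    simpa using hz
  -- On the line `u = 0` the chord direction is the velocity, so `θ` and `α` differ there by a
  -- constant.
  have hbase : θ (a + L) - α (a + L, 0) = θ a - α (a, 0) := by
    refine eq_of_exp_mul_I_eq (f := fun s => θ s - α (s, 0)) (by fun_prop) (z := 1)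
      (fun s => ?_) _ _
    have e0 : G (s, 0) = deriv γ s := by
      simp only [G]; rw [hcid 0 le_rfl hL.le, chordDirection_zero hL.ne' hd h hp]
    have hn : (‖deriv γ s‖ : ℂ) ≠ 0 := by simpa using hreg s
    have hne : deriv γ s / (‖deriv γ s‖ : ℂ) ≠ 0 := div_ne_zero (hreg s) hn
    have e1 : Complex.exp (θ s * Complex.I) = deriv γ s / ‖deriv γ s‖ := by
      rw [eq_div_iff hn, mul_comm]; exact (hθγ s).symm
    push_cast
    rw [sub_mul, Complex.exp_sub, hαexp, e0, e1, div_self hne]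
  refine ⟨a, ?_⟩
  rw [show θ (a + L) - θ a = 2 * (α (a, L) - α (a, 0)) by linarith, abs_mul, leg1]
  norm_num

/-! ### Locally constant functions and counting steps -/

theorem eventually_nhdsNE_iff_left_right {t : ℝ} {p : ℝ → Prop} :
    (∀ᶠ s in 𝓝[≠] t, p s) ↔ (∀ᶠ s in 𝓝[<] t, p s) ∧ ∀ᶠ s in 𝓝[>] t, p s := by
  rw [← nhdsLT_sup_nhdsGT, eventually_sup]

theorem eventually_nhds_of_left_right {t : ℝ} {p : ℝ → Prop} (h0 : p t)
    (hl : ∀ᶠ s in 𝓝[<] t, p s) (hr : ∀ᶠ s in 𝓝[>] t, p s) : ∀ᶠ s in 𝓝 t, p s := by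
  rw [← nhdsNE_sup_pure, eventually_sup]
  exact ⟨eventually_nhdsNE_iff_left_right.mpr ⟨hl, hr⟩, by simpa using h0⟩

/-- A function which is constant on a punctured neighbourhood of every point takes the same
constant value near all points. -/
theorem exists_eventually_nhdsNE_eq {X : Type*} {f : ℝ → X}
    (h : ∀ t, ∃ c, ∀ᶠ s in 𝓝[≠] t, f s = c) : ∃ c, ∀ t, ∀ᶠ s in 𝓝[≠] t, f s = c := by
  choose c hc using h
  have hloc : IsLocallyConstant c := by
    rw [IsLocallyConstant.iff_eventually_eq]
    intro t
    change ∀ᶠ s in 𝓝 t, c s = c t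
    rw [← nhdsNE_sup_pure, eventually_sup]
    refine ⟨?_, by simp⟩
    -- For `s` close to `t`, the punctured neighbourhoods of `s` and `t` on which `f` is constant
    -- overlap, so the two constants coincide.
    have h1 : ∀ᶠ s in 𝓝[≠] t, ∀ᶠ u in 𝓝 s, u ∈ ({t}ᶜ : Set ℝ) → f u = c t :=
      Eventually.filter_mono nhdsWithin_le_nhds
        (eventually_eventually_nhds.mpr (eventually_nhdsWithin_iff.mp (hc t)))
    filter_upwards [h1, self_mem_nhdsWithin] with s hs hst
    have h2 : ∀ᶠ u in 𝓝[≠] s, u ∈ ({t}ᶜ : Set ℝ) :=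
      Eventually.filter_mono nhdsWithin_le_nhds (isOpen_compl_singleton.mem_nhds hst)
    obtain ⟨u, h3, h4, h5⟩ :=
      ((hc s).and (h2.and (Eventually.filter_mono nhdsWithin_le_nhds hs))).exists
    rw [← h3, h5 h4]
  exact ⟨c 0, fun t => by rw [hloc.apply_eq_of_preconnectedSpace 0 t]; exact hc t⟩

/-- A function with values in a discrete set of multiples which has a limit is eventually
constant. -/
theorem eventually_eq_of_tendsto_of_int_multiple {l : Filter ℝ} [l.NeBot] {f : ℝ → ℝ} {b r : ℝ}
    (hr : 0 < r) (hf : Tendsto f l (𝓝 b)) (hint : ∀ᶠ s in l, ∃ n : ℤ, f s = n * r) :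
    ∃ c, ∀ᶠ s in l, f s = c := by
  have h1 : ∀ᶠ s in l, |f s - b| < r / 2 := by
    have := Metric.tendsto_nhds.mp hf (r / 2) (by linarith)
    simpa [Real.dist_eq] using this
  obtain ⟨s₀, h2, n, hn⟩ := (h1.and hint).exists
  refine ⟨n * r, ?_⟩
  filter_upwards [h1, hint] with s hs ⟨m, hm⟩
  rw [hm] at hs ⊢
  rw [hn] at h2
  rw [abs_lt] at hs h2
  have h3 : ((m : ℝ) - n) * r < 1 * r := by linarith
  have h4 : (-1 : ℝ) * r < ((m : ℝ) - n) * r := by linarith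
  have h5 := lt_of_mul_lt_mul_right h3 hr.le
  have h6 := lt_of_mul_lt_mul_right h4 hr.le
  have h7 : m - n < 1 := by exact_mod_cast h5
  have h8 : -1 < m - n := by exact_mod_cast h6
  have : m = n := by omega
  rw [this]

/-- The step function counting the points of a periodic set. -/
theorem exists_step_function {C : Set ℝ} {L : ℝ} (hL : 0 < L) (hper : ∀ t, t + L ∈ C ↔ t ∈ C)
    (hfin : {t ∈ Ico 0 L | t ∈ C}.Finite) :
    ∃ N : ℝ → ℤ, (∀ t, N (t + L) = N t + {t ∈ Ico 0 L | t ∈ C}.ncard) ∧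
      (∀ t, ∀ᶠ u in 𝓝[<] t, N u = N t) ∧ (∀ t ∈ C, ∀ᶠ u in 𝓝[>] t, N u = N t + 1) ∧
      ∀ t ∉ C, ∀ᶠ u in 𝓝[>] t, N u = N t := by
  classical
  -- The ceiling makes each summand left-continuous, with its unit jump immediately after the points
  -- `c + n * L`.
  let N : ℝ → ℤ := fun t => ∑ c ∈ hfin.toFinset, ⌈(t - c) / L⌉
  have hp : ∀ c, Monotone fun t : ℝ => (t - c) / L := fun c a b hab => by
    simp only; gcongr
  have hsl : ∀ c t, Tendsto (fun t : ℝ => (t - c) / L) (𝓝[<] t) (𝓝[≤] ((t - c) / L)) := fun c t =>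
    tendsto_nhdsWithin_of_tendsto_nhds_of_eventually_within _
      ((by fun_prop : Continuous fun t : ℝ => (t - c) / L).continuousAt.mono_left
        nhdsWithin_le_nhds)
      (by filter_upwards [self_mem_nhdsWithin] with u hu using hp c (le_of_lt hu))
  have hsr : ∀ c t, Tendsto (fun t : ℝ => (t - c) / L) (𝓝[>] t) (𝓝[>] ((t - c) / L)) := fun c t =>
    tendsto_nhdsWithin_of_tendsto_nhds_of_eventually_within _
      ((by fun_prop : Continuous fun t : ℝ => (t - c) / L).continuousAt.mono_left
        nhdsWithin_le_nhds)
      (by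
        filter_upwards [self_mem_nhdsWithin] with u hu
        exact div_lt_div_of_pos_right (sub_lt_sub_right hu c) hL)
  have hleft : ∀ t, ∀ᶠ u in 𝓝[<] t, N u = N t := fun t => by
    have : ∀ᶠ u in 𝓝[<] t, ∀ c ∈ hfin.toFinset, ⌈(u - c) / L⌉ = ⌈(t - c) / L⌉ := by
      rw [Filter.eventually_all_finset]
      intro c _
      have := (tendsto_ceil_left_pure_ceil ((t - c) / L)).comp (hsl c t)
      simpa [tendsto_pure] using this
    filter_upwards [this] with u hu using Finset.sum_congr rfl hu
  -- The jump `⌊x⌋ + 1 - ⌈x⌉` is `1` if `x` is an integer and `0` otherwise.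
  have hright : ∀ t, ∀ᶠ u in 𝓝[>] t, N u =
      N t + ∑ c ∈ hfin.toFinset, (⌊(t - c) / L⌋ + 1 - ⌈(t - c) / L⌉) := fun t => by
    have : ∀ᶠ u in 𝓝[>] t, ∀ c ∈ hfin.toFinset, ⌈(u - c) / L⌉ = ⌊(t - c) / L⌋ + 1 := by
      rw [Filter.eventually_all_finset]
      intro c _
      have := (tendsto_ceil_right_pure_floor_add_one ((t - c) / L)).comp (hsr c t)
      simpa [tendsto_pure] using this
    filter_upwards [this] with u hu
    rw [← Finset.sum_add_distrib]
    exact Finset.sum_congr rfl fun c hc => by rw [hu c hc]; ring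
  have hperz : ∀ (n : ℤ) t, t + n * L ∈ C ↔ t ∈ C := by
    have : Function.Periodic (fun t => t ∈ C) L := fun t => propext (hper t)
    intro n t
    exact iff_of_eq (this.int_mul n t)
  have hzero : ∀ t c, (¬ ∃ n : ℤ, t = c + n * L) → ⌊(t - c) / L⌋ + 1 - ⌈(t - c) / L⌉ = 0 := by
    intro t c hn
    have h1 : ⌈(t - c) / L⌉ = ⌊(t - c) / L⌋ + 1 := by
      rw [Int.ceil_eq_iff]
      push_cast
      refine ⟨?_, (Int.lt_floor_add_one _).le⟩
      rw [add_sub_cancel_right]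
      refine lt_of_le_of_ne (Int.floor_le _) fun h => hn ⟨⌊(t - c) / L⌋, ?_⟩
      rw [h]; field_simp; ring
    rw [h1, sub_self]
  refine ⟨N, fun t => ?_, hleft, fun t ht => ?_, fun t ht => ?_⟩
  · simp only [N]
    rw [Set.ncard_eq_toFinset_card _ hfin, Finset.card_eq_sum_ones]
    push_cast
    rw [← Finset.sum_add_distrib]
    refine Finset.sum_congr rfl fun c _ => ?_
    rw [show (t + L - c) / L = (t - c) / L + 1 by field_simp; ring, Int.ceil_add_one]
  · have htm : t = toIcoMod hL 0 t + (toIcoDiv hL 0 t : ℤ) * L := by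
      have := toIcoMod_add_toIcoDiv_zsmul hL 0 t
      rw [zsmul_eq_mul] at this
      exact this.symm
    have hIco : toIcoMod hL 0 t ∈ Ico 0 L := by simpa using toIcoMod_mem_Ico hL 0 t
    -- Only the representative of `t` in `[0, L)` is congruent to `t` modulo `L`, so a single
    -- summand jumps.
    have hsum : ∑ c ∈ hfin.toFinset, (⌊(t - c) / L⌋ + 1 - ⌈(t - c) / L⌉) = 1 := by
      rw [Finset.sum_eq_single (toIcoMod hL 0 t)]
      · have : (t - toIcoMod hL 0 t) / L = (toIcoDiv hL 0 t : ℤ) := by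
          rw [div_eq_iff hL.ne']; linarith
        rw [this]; simp
      · rintro c hc hne
        refine hzero t c ?_
        rintro ⟨n, hn⟩
        apply hne
        have hc' : c ∈ Ico 0 L := by
          rw [Set.Finite.mem_toFinset] at hc; exact hc.1
        have h1 : toIcoMod hL 0 t = toIcoMod hL 0 c := by
          rw [hn, ← zsmul_eq_mul, toIcoMod_add_zsmul]
        rw [h1, eq_comm, toIcoMod_eq_self]
        simpa using hc'
      · intro hnot
        exfalso; apply hnot
        rw [Set.Finite.mem_toFinset]
        refine ⟨hIco, ?_⟩
        rw [htm, hperz] at ht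
        exact ht
    simpa only [hsum] using hright t
  · have hsum : ∑ c ∈ hfin.toFinset, (⌊(t - c) / L⌋ + 1 - ⌈(t - c) / L⌉) = 0 := by
      refine Finset.sum_eq_zero fun c hc => hzero t c ?_
      rintro ⟨n, rfl⟩
      rw [hperz] at ht
      rw [Set.Finite.mem_toFinset] at hc
      exact ht hc.2
    simpa only [hsum, add_zero] using hright t

/-! ### Signs near isolated zeros and local extrema -/

theorem eventually_pos_or_neg_right {g : ℝ → ℝ} (hg : Continuous g) {t : ℝ}
    (h : ∀ᶠ s in 𝓝[>] t, g s ≠ 0) : (∀ᶠ s in 𝓝[>] t, 0 < g s) ∨ ∀ᶠ s in 𝓝[>] t, g s < 0 := by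
  obtain ⟨b, hb, hsub⟩ := mem_nhdsGT_iff_exists_Ioo_subset.mp h
  have hb' : t < b := hb
  have hmem : Ioo t b ∈ 𝓝[>] t := Ioo_mem_nhdsGT hb'
  have hm : (t + b) / 2 ∈ Ioo t b := ⟨by linarith, by linarith⟩
  rcases lt_or_gt_of_ne (hsub hm) with h0 | h0
  · right
    filter_upwards [hmem] with s hs
    by_contra! hcon
    obtain ⟨x, hx, hx0⟩ :=
      isPreconnected_Ioo.intermediate_value hm hs hg.continuousOn ⟨h0.le, hcon⟩
    exact hsub hx hx0
  · left
    filter_upwards [hmem] with s hs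
    by_contra! hcon
    obtain ⟨x, hx, hx0⟩ :=
      isPreconnected_Ioo.intermediate_value hs hm hg.continuousOn ⟨hcon, h0.le⟩
    exact hsub hx hx0

theorem eventually_pos_or_neg_left {g : ℝ → ℝ} (hg : Continuous g) {t : ℝ}
    (h : ∀ᶠ s in 𝓝[<] t, g s ≠ 0) : (∀ᶠ s in 𝓝[<] t, 0 < g s) ∨ ∀ᶠ s in 𝓝[<] t, g s < 0 := by
  obtain ⟨b, hb, hsub⟩ := mem_nhdsLT_iff_exists_Ioo_subset.mp h
  have hb' : b < t := hb
  have hmem : Ioo b t ∈ 𝓝[<] t := Ioo_mem_nhdsLT hb'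
  have hm : (b + t) / 2 ∈ Ioo b t := ⟨by linarith, by linarith⟩
  rcases lt_or_gt_of_ne (hsub hm) with h0 | h0
  · right
    filter_upwards [hmem] with s hs
    by_contra! hcon
    obtain ⟨x, hx, hx0⟩ :=
      isPreconnected_Ioo.intermediate_value hm hs hg.continuousOn ⟨h0.le, hcon⟩
    exact hsub hx hx0
  · left
    filter_upwards [hmem] with s hs
    by_contra! hcon
    obtain ⟨x, hx, hx0⟩ :=
      isPreconnected_Ioo.intermediate_value hs hm hg.continuousOn ⟨hcon, h0.le⟩
    exact hsub hx hx0

theorem eventually_lt_right_of_deriv_pos {f : ℝ → ℝ} (hf : Continuous f) {t : ℝ}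
    (h : ∀ᶠ s in 𝓝[>] t, 0 < deriv f s) : ∀ᶠ s in 𝓝[>] t, f t < f s := by
  obtain ⟨b, hb, hsub⟩ := mem_nhdsGT_iff_exists_Ioo_subset.mp h
  have hb' : t < b := hb
  have hmono : StrictMonoOn f (Icc t b) :=
    strictMonoOn_of_deriv_pos (convex_Icc t b) hf.continuousOn fun x hx =>
      hsub (by simpa using hx)
  filter_upwards [Ioo_mem_nhdsGT hb'] with s hs
  exact hmono ⟨le_rfl, hb'.le⟩ ⟨hs.1.le, hs.2.le⟩ hs.1

theorem eventually_lt_left_of_deriv_pos {f : ℝ → ℝ} (hf : Continuous f) {t : ℝ}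
    (h : ∀ᶠ s in 𝓝[<] t, 0 < deriv f s) : ∀ᶠ s in 𝓝[<] t, f s < f t := by
  obtain ⟨b, hb, hsub⟩ := mem_nhdsLT_iff_exists_Ioo_subset.mp h
  have hb' : b < t := hb
  have hmono : StrictMonoOn f (Icc b t) :=
    strictMonoOn_of_deriv_pos (convex_Icc b t) hf.continuousOn fun x hx =>
      hsub (by simpa using hx)
  filter_upwards [Ioo_mem_nhdsLT hb'] with s hs
  exact hmono ⟨hs.1.le, hs.2.le⟩ ⟨hb'.le, le_rfl⟩ hs.2

theorem eventually_lt_right_of_deriv_neg {f : ℝ → ℝ} (hf : Continuous f) {t : ℝ}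
    (h : ∀ᶠ s in 𝓝[>] t, deriv f s < 0) : ∀ᶠ s in 𝓝[>] t, f s < f t := by
  have := eventually_lt_right_of_deriv_pos (f := fun s => -f s) hf.neg (t := t)
    (by simpa [deriv.fun_neg] using h)
  simpa using this

theorem eventually_lt_left_of_deriv_neg {f : ℝ → ℝ} (hf : Continuous f) {t : ℝ}
    (h : ∀ᶠ s in 𝓝[<] t, deriv f s < 0) : ∀ᶠ s in 𝓝[<] t, f t < f s := by
  have := eventually_lt_left_of_deriv_pos (f := fun s => -f s) hf.neg (t := t)
    (by simpa [deriv.fun_neg] using h)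
  simpa using this

/-- If the critical points of `f` are isolated, then the derivative has a constant sign on either
side of every point, and the point is a local extremum exactly when these signs differ. -/
theorem exists_sign_deriv {f : ℝ → ℝ} (hf : Continuous f) (hf' : Continuous (deriv f)) {t : ℝ}
    (h : ∀ᶠ s in 𝓝[≠] t, deriv f s ≠ 0) :
    ∃ σ τ : ℝ, (σ = 1 ∨ σ = -1) ∧ (τ = 1 ∨ τ = -1) ∧
      (∀ᶠ s in 𝓝[<] t, Real.sign (deriv f s) = σ) ∧
      (∀ᶠ s in 𝓝[>] t, Real.sign (deriv f s) = τ) ∧ (IsLocalExtr f t ↔ τ = -σ) := by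
  rw [eventually_nhdsNE_iff_left_right] at h
  have notmin_right : (∀ᶠ s in 𝓝[>] t, f s < f t) → ¬ IsLocalMin f t := fun h1 h2 => by
    obtain ⟨s, h3, h4⟩ := (h1.and (h2.filter_mono nhdsWithin_le_nhds)).exists
    exact absurd h3 (not_lt.mpr h4)
  have notmin_left : (∀ᶠ s in 𝓝[<] t, f s < f t) → ¬ IsLocalMin f t := fun h1 h2 => by
    obtain ⟨s, h3, h4⟩ := (h1.and (h2.filter_mono nhdsWithin_le_nhds)).exists
    exact absurd h3 (not_lt.mpr h4)
  have notmax_right : (∀ᶠ s in 𝓝[>] t, f t < f s) → ¬ IsLocalMax f t := fun h1 h2 => by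
    obtain ⟨s, h3, h4⟩ := (h1.and (h2.filter_mono nhdsWithin_le_nhds)).exists
    exact absurd h3 (not_lt.mpr h4)
  have notmax_left : (∀ᶠ s in 𝓝[<] t, f t < f s) → ¬ IsLocalMax f t := fun h1 h2 => by
    obtain ⟨s, h3, h4⟩ := (h1.and (h2.filter_mono nhdsWithin_le_nhds)).exists
    exact absurd h3 (not_lt.mpr h4)
  rcases eventually_pos_or_neg_left hf' h.1 with hl | hl <;>
    rcases eventually_pos_or_neg_right hf' h.2 with hr | hr
  · refine ⟨1, 1, by simp, by simp, hl.mono fun s => Real.sign_of_pos,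
      hr.mono fun s => Real.sign_of_pos, ⟨fun he => ?_, fun he => by norm_num at he⟩⟩
    exact (he.elim (notmin_left (eventually_lt_left_of_deriv_pos hf hl))
      (notmax_right (eventually_lt_right_of_deriv_pos hf hr))).elim
  · refine ⟨1, -1, by simp, by simp, hl.mono fun s => Real.sign_of_pos,
      hr.mono fun s => Real.sign_of_neg, ⟨fun _ => rfl, fun _ => Or.inr ?_⟩⟩
    exact eventually_nhds_of_left_right le_rfl
      ((eventually_lt_left_of_deriv_pos hf hl).mono fun _ => le_of_lt)
      ((eventually_lt_right_of_deriv_neg hf hr).mono fun _ => le_of_lt)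
  · refine ⟨-1, 1, by simp, by simp, hl.mono fun s => Real.sign_of_neg,
      hr.mono fun s => Real.sign_of_pos, ⟨fun _ => by norm_num, fun _ => Or.inl ?_⟩⟩
    exact eventually_nhds_of_left_right le_rfl
      ((eventually_lt_left_of_deriv_neg hf hl).mono fun _ => le_of_lt)
      ((eventually_lt_right_of_deriv_pos hf hr).mono fun _ => le_of_lt)
  · refine ⟨-1, -1, by simp, by simp, hl.mono fun s => Real.sign_of_neg,
      hr.mono fun s => Real.sign_of_neg, ⟨fun he => ?_, fun he => by norm_num at he⟩⟩
    exact (he.elim (notmin_right (eventually_lt_right_of_deriv_neg hf hr))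
      (notmax_left (eventually_lt_left_of_deriv_neg hf hl))).elim

/-- The zeros of a continuous periodic function with finitely many zeros in a period are
isolated. -/
theorem eventually_ne_zero_of_finite_zeros {g : ℝ → ℝ} {L : ℝ} (hL : 0 < L)
    (hg : Function.Periodic g L) (hfin : {t ∈ Ico 0 L | g t = 0}.Finite) (t : ℝ) :
    ∀ᶠ s in 𝓝[≠] t, g s ≠ 0 := by
  -- A window of length `2 * L` around `t` meets only the period containing `t` and its two
  -- neighbours.
  have hfin2 : {s | g s = 0 ∧ s ∈ Ioo (t - L) (t + L)}.Finite := by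
    let n := toIcoDiv hL 0 t
    refine (((hfin.image fun c => c + (n - 1 : ℤ) * L).union
      (hfin.image fun c => c + (n : ℤ) * L)).union
      (hfin.image fun c => c + (n + 1 : ℤ) * L)).subset ?_
    rintro s ⟨hs0, hs1, hs2⟩
    have h1 : t = toIcoMod hL 0 t + n * L := by
      have := toIcoMod_add_toIcoDiv_zsmul hL 0 t
      rw [zsmul_eq_mul] at this
      exact this.symm
    have h2 : s = toIcoMod hL 0 s + (toIcoDiv hL 0 s : ℤ) * L := by
      have := toIcoMod_add_toIcoDiv_zsmul hL 0 s
      rw [zsmul_eq_mul] at this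
      exact this.symm
    have h3 : toIcoMod hL 0 t ∈ Ico 0 L := by simpa using toIcoMod_mem_Ico hL 0 t
    have h4 : toIcoMod hL 0 s ∈ Ico 0 L := by simpa using toIcoMod_mem_Ico hL 0 s
    have h5 : toIcoMod hL 0 s ∈ {t ∈ Ico 0 L | g t = 0} := by
      refine ⟨h4, ?_⟩
      rw [toIcoMod, hg.sub_zsmul_eq, hs0]
    have h6 : ((toIcoDiv hL 0 s : ℝ) - n) * L < 2 * L := by nlinarith [h3.1, h3.2, h4.1, h4.2]
    have h7 : (-2) * L < ((toIcoDiv hL 0 s : ℝ) - n) * L := by nlinarith [h3.1, h3.2, h4.1, h4.2]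
    have h8 := lt_of_mul_lt_mul_right h6 hL.le
    have h9 := lt_of_mul_lt_mul_right h7 hL.le
    have h10 : toIcoDiv hL 0 s - n < 2 := by exact_mod_cast h8
    have h11 : -2 < toIcoDiv hL 0 s - n := by exact_mod_cast h9
    have h12 : toIcoDiv hL 0 s = n - 1 ∨ toIcoDiv hL 0 s = n ∨ toIcoDiv hL 0 s = n + 1 := by
      omega
    rcases h12 with h | h | h <;> rw [h] at h2
    · exact Or.inl (Or.inl ⟨_, h5, h2.symm⟩)
    · exact Or.inl (Or.inr ⟨_, h5, h2.symm⟩)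
    · exact Or.inr ⟨_, h5, h2.symm⟩
  have h1 : ∀ᶠ s in 𝓝[≠] t, s ∉ {s | g s = 0 ∧ s ∈ Ioo (t - L) (t + L)} := by
    have := (hfin2.subset (sdiff_subset (t := {t}))).isClosed.isOpen_compl.mem_nhds
      (x := t) (by simp)
    filter_upwards [nhdsWithin_le_nhds this, self_mem_nhdsWithin] with s hs hst hmem
    exact hs ⟨hmem, hst⟩
  have h2 : ∀ᶠ s in 𝓝[≠] t, s ∈ Ioo (t - L) (t + L) :=
    nhdsWithin_le_nhds (Ioo_mem_nhds (by linarith) (by linarith))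
  filter_upwards [h1, h2] with s hs1 hs2 hs0
  exact hs1 ⟨hs0, hs2⟩

/-! ### Curvature, tangent angle and evolute -/

theorem ContDiff.deriv_of_infty {γ : ℝ → ℂ} (h : ContDiff ℝ ∞ γ) : ContDiff ℝ ∞ (deriv γ) :=
  (contDiff_infty_iff_deriv.mp h).2

theorem contDiff_signedCurvature {γ : ℝ → ℂ} (h : ContDiff ℝ ∞ γ) (hreg : ∀ t, deriv γ t ≠ 0) :
    ContDiff ℝ ∞ (signedCurvature γ) := by
  have h1 := h.deriv_of_infty
  have h2 := h1.deriv_of_infty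
  unfold signedCurvature
  refine ContDiff.div ?_ ((h1.norm ℝ hreg).pow 3) fun t => by simpa using hreg t
  exact Complex.imCLM.contDiff.comp ((Complex.conjCLE.contDiff.comp h1).mul h2)

theorem signedCurvature_periodic {γ : ℝ → ℂ} {L : ℝ} (hp : Function.Periodic γ L) :
    Function.Periodic (signedCurvature γ) L := fun t => by
  unfold signedCurvature
  rw [hp.deriv_periodic, hp.deriv_periodic.deriv_periodic]

/-- A regular curve has a differentiable tangent angle. -/
theorem exists_tangent_angle {γ : ℝ → ℂ} (h : ContDiff ℝ ∞ γ) (hreg : ∀ t, deriv γ t ≠ 0) :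
    ∃ θ : ℝ → ℝ, (∀ t, deriv γ t = ‖deriv γ t‖ * Complex.exp (θ t * Complex.I)) ∧
      ∀ t, HasDerivAt θ (signedCurvature γ t * ‖deriv γ t‖) t := by
  have h1 := h.deriv_of_infty
  have h2 := h1.deriv_of_infty
  have hd1 : ∀ t, HasDerivAt (deriv γ) (deriv (deriv γ) t) t := fun t =>
    (h1.differentiable (by simp) t).hasDerivAt
  have hq : Continuous fun t => deriv (deriv γ) t / deriv γ t :=
    h2.continuous.div h1.continuous hreg
  -- A smooth logarithm of the velocity, obtained by integrating its logarithmic derivative; its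
  -- imaginary part is the angle.
  let l : ℝ → ℂ := fun t => Complex.log (deriv γ 0) + ∫ s in (0 : ℝ)..t,
    deriv (deriv γ) s / deriv γ s
  have hl : ∀ t, HasDerivAt l (deriv (deriv γ) t / deriv γ t) t := fun t =>
    (hq.integral_hasStrictDerivAt 0 t).hasDerivAt.const_add _
  have hexp : ∀ t, deriv γ t = Complex.exp (l t) := by
    have hz : ∀ t, HasDerivAt (fun s => deriv γ s * Complex.exp (-l s)) 0 t := fun t => by
      have h3 := (hd1 t).mul ((hl t).neg.cexp)
      have hne := hreg t
      have e : deriv (deriv γ) t * Complex.exp (-l t) + deriv γ t *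
          (Complex.exp (-l t) * -(deriv (deriv γ) t / deriv γ t)) = 0 := by
        field_simp
        ring
      exact e ▸ h3
    have hc : ∀ t, deriv γ t * Complex.exp (-l t) = 1 := fun t => by
      rw [is_const_of_deriv_eq_zero (fun s => (hz s).differentiableAt) (fun s => (hz s).deriv) t 0]
      simp [l, Complex.exp_neg, Complex.exp_log (hreg 0), hreg 0]
    intro t
    have := hc t
    rw [Complex.exp_neg, mul_inv_eq_one₀ (Complex.exp_ne_zero _)] at this
    exact this
  refine ⟨fun t => (l t).im, fun t => ?_, fun t => ?_⟩
  · conv_lhs => rw [hexp t, ← Complex.re_add_im (l t), Complex.exp_add]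
    rw [hexp t, Complex.norm_exp, Complex.ofReal_exp]
  · have h3 : HasDerivAt (fun t => (l t).im) (deriv (deriv γ) t / deriv γ t).im t :=
      Complex.imCLM.hasFDerivAt.comp_hasDerivAt t (hl t)
    convert h3 using 1
    have hn : ‖deriv γ t‖ ≠ 0 := by simpa using hreg t
    rw [signedCurvature, Complex.div_im, Complex.normSq_eq_norm_sq, Complex.mul_im,
      Complex.conj_re, Complex.conj_im]
    field_simp
    ring

/-- The centre of curvature formula for the evolute. -/
theorem IsEvolute.eq_center {γ β : ℝ → ℂ} (h : ContDiff ℝ ∞ γ) (hreg : ∀ t, deriv γ t ≠ 0)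
    (hκ : ∀ t, signedCurvature γ t ≠ 0) (hβ : IsEvolute γ β) (t : ℝ) :
    β t = γ t + Complex.I * (deriv γ t / ‖deriv γ t‖) / signedCurvature γ t := by
  have h1 := h.deriv_of_infty
  obtain ⟨e1, e2⟩ := hβ t
  have hd : HasDerivAt (fun s => normalLineEq γ s (β t))
      ((conj (deriv (deriv γ) t) * (β t - γ t) + conj (deriv γ t) * (-deriv γ t)).re) t := by
    have ha : HasDerivAt (fun s => conj (deriv γ s)) (conj (deriv (deriv γ) t)) t :=
      Complex.conjCLE.toContinuousLinearMap.hasFDerivAt.comp_hasDerivAt t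
        (h1.differentiable (by simp) t).hasDerivAt
    have hb : HasDerivAt (fun s => β t - γ s) (-deriv γ t) t :=
      (h.differentiable (by simp) t).hasDerivAt.const_sub _
    exact Complex.reCLM.hasFDerivAt.comp_hasDerivAt t (ha.mul hb)
  rw [hd.deriv] at e2
  rw [normalLineEq] at e1
  have hn : ‖deriv γ t‖ ≠ 0 := by simpa using hreg t
  have hn2 := Complex.sq_norm (deriv γ t)
  rw [Complex.normSq_apply] at hn2
  have hD := hκ t
  have hκeq : signedCurvature γ t * ‖deriv γ t‖ ^ 3 =
      (conj (deriv γ t) * deriv (deriv γ) t).im := by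
    rw [signedCurvature]; field_simp
  -- The envelope conditions are two real linear equations for `β t - γ t`, with determinant `κ
  -- |γ'|³`; the combinations below are Cramer's rule.
  have hw : (β t - γ t) * signedCurvature γ t * ‖deriv γ t‖ = Complex.I * deriv γ t := by
    generalize signedCurvature γ t = k at *
    generalize ‖deriv γ t‖ = n at *
    generalize deriv (deriv γ) t = b at *
    generalize deriv γ t = a at *
    generalize β t - γ t = w at *
    simp only [Complex.mul_re, Complex.add_re, Complex.conj_re, Complex.conj_im, Complex.neg_re,
      Complex.neg_im, Complex.mul_im] at e1 e2 hκeq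
    have hn3 : n ^ 2 ≠ 0 := pow_ne_zero _ hn
    apply Complex.ext
    · simp only [Complex.mul_re, Complex.mul_im, Complex.ofReal_re, Complex.ofReal_im,
        Complex.I_re, Complex.I_im]
      apply mul_left_cancel₀ hn3
      linear_combination w.re * hκeq - a.im * e2 + b.im * e1 + a.im * hn2
    · simp only [Complex.mul_re, Complex.mul_im, Complex.ofReal_re, Complex.ofReal_im,
        Complex.I_re, Complex.I_im]
      apply mul_left_cancel₀ hn3
      linear_combination w.im * hκeq + a.re * e2 - b.re * e1 - a.re * hn2
  have hnC : (‖deriv γ t‖ : ℂ) ≠ 0 := by exact_mod_cast hn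
  have hkC : (signedCurvature γ t : ℂ) ≠ 0 := by exact_mod_cast hD
  rw [← mul_div_assoc, ← hw]
  field_simp
  ring

theorem IsEvolute.contDiff {γ β : ℝ → ℂ} (h : ContDiff ℝ ∞ γ) (hreg : ∀ t, deriv γ t ≠ 0)
    (hκ : ∀ t, signedCurvature γ t ≠ 0) (hβ : IsEvolute γ β) : ContDiff ℝ ∞ β := by
  have h1 := h.deriv_of_infty
  have hof : ContDiff ℝ ∞ ((↑) : ℝ → ℂ) := Complex.ofRealCLM.contDiff
  rw [funext (hβ.eq_center h hreg hκ)]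
  have hn : ContDiff ℝ ∞ fun t => (‖deriv γ t‖ : ℂ) := hof.comp (h1.norm ℝ hreg)
  have hn0 : ∀ t, (‖deriv γ t‖ : ℂ) ≠ 0 := fun t => by simpa using hreg t
  have hk0 : ∀ t, (signedCurvature γ t : ℂ) ≠ 0 := fun t => by simpa using hκ t
  simp only [div_eq_mul_inv]
  have hk : ContDiff ℝ ∞ fun t => (signedCurvature γ t : ℂ) :=
    hof.comp (contDiff_signedCurvature h hreg)
  exact h.add ((contDiff_const.mul (h1.mul (hn.inv hn0))).mul (hk.inv hk0))

theorem IsEvolute.periodic {γ β : ℝ → ℂ} {L : ℝ} (h : ContDiff ℝ ∞ γ)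
    (hreg : ∀ t, deriv γ t ≠ 0) (hκ : ∀ t, signedCurvature γ t ≠ 0)
    (hp : Function.Periodic γ L) (hβ : IsEvolute γ β) : Function.Periodic β L := fun t => by
  rw [hβ.eq_center h hreg hκ, hβ.eq_center h hreg hκ, hp, hp.deriv_periodic,
    signedCurvature_periodic hp]

theorem hasDerivAt_exp_mul_I {θ : ℝ → ℝ} {θ' t : ℝ} (h : HasDerivAt θ θ' t) :
    HasDerivAt (fun s => Complex.exp (θ s * Complex.I))
      (Complex.exp (θ t * Complex.I) * (θ' * Complex.I)) t :=
  (h.ofReal_comp.mul_const Complex.I).cexp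

/-- The velocity of the evolute is normal to the curve. -/
theorem IsEvolute.deriv_eq {γ β : ℝ → ℂ} (h : ContDiff ℝ ∞ γ) (hreg : ∀ t, deriv γ t ≠ 0)
    (hκ : ∀ t, signedCurvature γ t ≠ 0) (hβ : IsEvolute γ β) {θ : ℝ → ℝ}
    (hθ : ∀ t, deriv γ t = ‖deriv γ t‖ * Complex.exp (θ t * Complex.I))
    (hθ' : ∀ t, HasDerivAt θ (signedCurvature γ t * ‖deriv γ t‖) t) (t : ℝ) :
    deriv β t = ((-deriv (signedCurvature γ) t / signedCurvature γ t ^ 2 : ℝ) : ℂ) *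
      (Complex.I * Complex.exp (θ t * Complex.I)) := by
  have hβeq : β = fun t => γ t + Complex.I * Complex.exp (θ t * Complex.I) / signedCurvature γ t := by
    funext s
    have hn : (‖deriv γ s‖ : ℂ) ≠ 0 := by simpa using hreg s
    have : Complex.exp (θ s * Complex.I) = deriv γ s / ‖deriv γ s‖ := by
      rw [eq_div_iff hn, mul_comm]; exact (hθ s).symm
    rw [this, hβ.eq_center h hreg hκ]
  have hkC : (signedCurvature γ t : ℂ) ≠ 0 := by exact_mod_cast hκ t
  have hk : HasDerivAt (fun s => (signedCurvature γ s : ℂ)) (deriv (signedCurvature γ) t : ℝ) t :=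
    ((contDiff_signedCurvature h hreg).differentiable (by simp) t).hasDerivAt.ofReal_comp
  have hd := ((h.differentiable (by simp) t).hasDerivAt).add
    -- Since `θ' = κ |γ'|`, differentiating the exponential yields `-γ'`, which cancels the first
    -- term; only the derivative of `1 / κ` survives.
    (((hasDerivAt_exp_mul_I (hθ' t)).const_mul Complex.I).div hk hkC)
  rw [hβeq]
  refine hd.deriv.trans ?_
  have hθt := hθ t
  generalize ‖deriv γ t‖ = n at hθt ⊢
  rw [hθt]
  push_cast
  field_simp
  ring_nf
  rw [Complex.I_sq]
  ring

section Front

/-! Curves whose velocity is `μ * I * exp (θ * I)`, with a differentiable decreasing angle `θ`. -/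

theorem unitTangent_eq_sign {β : ℝ → ℂ} {μ θ : ℝ → ℝ}
    (hβ : ∀ t, deriv β t = μ t * (Complex.I * Complex.exp (θ t * Complex.I))) (t : ℝ) :
    unitTangent β t = Real.sign (μ t) * (Complex.I * Complex.exp (θ t * Complex.I)) := by
  have hn : ‖deriv β t‖ = |μ t| := by
    rw [hβ, norm_mul, norm_mul, Complex.norm_exp_ofReal_mul_I, Complex.norm_I, Complex.norm_real]
    simp
  rw [unitTangent, hn, hβ]
  rcases lt_trichotomy (μ t) 0 with h | h | h
  · have : (μ t : ℂ) ≠ 0 := by exact_mod_cast h.ne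
    rw [Real.sign_of_neg h, abs_of_neg h]
    push_cast
    field_simp
  · simp [h]
  · have : (μ t : ℂ) ≠ 0 := by exact_mod_cast h.ne'
    rw [Real.sign_of_pos h, abs_of_pos h]
    push_cast
    field_simp

/-- The frame `I * exp (θ * I)` is continuous and nonzero, so the one-sided limits of the unit
tangent are `σ` and `τ` times the same vector. -/
theorem isCurveCusp_iff_sign {β : ℝ → ℂ} {μ θ : ℝ → ℝ} (hθ : Continuous θ)
    (hβ : ∀ t, deriv β t = μ t * (Complex.I * Complex.exp (θ t * Complex.I))) {t σ τ : ℝ}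
    (hσ : σ = 1 ∨ σ = -1) (hl : ∀ᶠ s in 𝓝[<] t, Real.sign (μ s) = σ)
    (hr : ∀ᶠ s in 𝓝[>] t, Real.sign (μ s) = τ) : IsCurveCusp β t ↔ τ = -σ := by
  have hN : Continuous fun s => Complex.I * Complex.exp (θ s * Complex.I) := by fun_prop
  have hlim : ∀ (l : Filter ℝ) (ρ : ℝ), l ≤ 𝓝 t → (∀ᶠ s in l, Real.sign (μ s) = ρ) →
      Tendsto (unitTangent β) l (𝓝 (ρ * (Complex.I * Complex.exp (θ t * Complex.I)))) := by
    intro l ρ hle h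
    refine ((hN.continuousAt.mono_left hle).const_mul (ρ : ℂ)).congr' ?_
    filter_upwards [h] with s hs
    rw [unitTangent_eq_sign hβ, hs]
  have h1 := hlim _ σ nhdsWithin_le_nhds hl
  have h2 := hlim _ τ nhdsWithin_le_nhds hr
  have hne : Complex.I * Complex.exp (θ t * Complex.I) ≠ 0 :=
    mul_ne_zero Complex.I_ne_zero (Complex.exp_ne_zero _)
  constructor
  · rintro ⟨v, -, hv1, hv2⟩
    have e1 := tendsto_nhds_unique hv1 h1
    have e2 := tendsto_nhds_unique hv2 h2
    rw [e1, ← neg_mul] at e2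
    have := mul_right_cancel₀ hne e2
    exact_mod_cast this.symm
  · rintro rfl
    refine ⟨_, mul_ne_zero ?_ hne, h1, ?_⟩
    · rcases hσ with rfl | rfl <;> norm_num
    · rw [← neg_mul]; exact_mod_cast h2

/-- The determinant of `deriv β t` and `β s - β t` has `s`-derivative `μ t * μ s * sin (θ s - θ t)`.
Near a regular point the product of the `μ`'s is positive and `θ` decreases, so the determinant
rises to its value `0` at `t` and then falls. -/
theorem isStandardlyOriented_of_angle {β : ℝ → ℂ} {μ θ : ℝ → ℝ} (hdiff : Differentiable ℝ β)
    (hμ : Continuous μ) (hθ : Continuous θ) (hanti : StrictAnti θ)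
    (hβ : ∀ t, deriv β t = μ t * (Complex.I * Complex.exp (θ t * Complex.I))) :
    IsStandardlyOriented β := by
  intro t ht
  have hμt : μ t ≠ 0 := fun h0 => ht (by rw [hβ, h0]; simp)
  let g : ℝ → ℝ := fun s => (conj (deriv β t) * (β s - β t)).im
  have hg : ∀ s, HasDerivAt g (μ t * μ s * Real.sin (θ s - θ t)) s := fun s => by
    have h1 : HasDerivAt g (conj (deriv β t) * deriv β s).im s :=
      Complex.imCLM.hasFDerivAt.comp_hasDerivAt s
        (((hdiff s).hasDerivAt.sub_const _).const_mul _)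
    convert h1 using 1
    rw [hβ, hβ, Complex.exp_mul_I, Complex.exp_mul_I, Real.sin_sub]
    simp only [← Complex.ofReal_cos, ← Complex.ofReal_sin, map_mul, map_add, Complex.conj_I,
      Complex.conj_ofReal, Complex.mul_re, Complex.mul_im, Complex.add_re, Complex.add_im,
      Complex.neg_re, Complex.neg_im, Complex.I_re, Complex.I_im, Complex.ofReal_re,
      Complex.ofReal_im]
    ring
  have hgc : Continuous g := continuous_iff_continuousAt.mpr fun s => (hg s).continuousAt
  have hpos : ∀ᶠ s in 𝓝 t, 0 < μ t * μ s :=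
    ((continuous_const.mul hμ).tendsto t).eventually
      (lt_mem_nhds (mul_self_pos.mpr hμt))
  have hθt : Tendsto (fun s => θ s - θ t) (𝓝 t) (𝓝 0) := by
    have : Continuous fun s => θ s - θ t := by fun_prop
    simpa using this.tendsto t
  have hlo : ∀ᶠ s in 𝓝 t, -Real.pi < θ s - θ t :=
    hθt.eventually (lt_mem_nhds (neg_lt_zero.mpr Real.pi_pos))
  have hhi : ∀ᶠ s in 𝓝 t, θ s - θ t < Real.pi := hθt.eventually (gt_mem_nhds Real.pi_pos)
  have hg0 : g t = 0 := by simp [g]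
  rw [eventually_nhdsNE_iff_left_right]
  constructor
  · have := eventually_lt_left_of_deriv_pos hgc (t := t) (by
      filter_upwards [hpos.filter_mono nhdsWithin_le_nhds, hhi.filter_mono nhdsWithin_le_nhds,
        self_mem_nhdsWithin] with s h1 h2 h3
      rw [(hg s).deriv]
      exact mul_pos h1 (Real.sin_pos_of_pos_of_lt_pi (sub_pos.mpr (hanti h3)) h2))
    rwa [hg0] at this
  · have := eventually_lt_right_of_deriv_neg hgc (t := t) (by
      filter_upwards [hpos.filter_mono nhdsWithin_le_nhds, hlo.filter_mono nhdsWithin_le_nhds,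
        self_mem_nhdsWithin] with s h1 h2 h3
      rw [(hg s).deriv]
      exact mul_neg_of_pos_of_neg h1
        (Real.sin_neg_of_neg_of_neg_pi_lt (sub_neg.mpr (hanti h3)) h2))
    rwa [hg0] at this

end Front

/-! ### Uniqueness and existence of tangent angles -/

/-- Two tangent angles of a curve with isolated singular points differ by a constant at its
regular points. -/
theorem IsTangentAngle.exists_sub_eq {β : ℝ → ℂ} {φ ψ : ℝ → ℝ} (hφ : IsTangentAngle β φ)
    (hψ : IsTangentAngle β ψ) (hiso : ∀ t, ∀ᶠ s in 𝓝[≠] t, deriv β s ≠ 0)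
    (hreg : ∀ t, deriv β t ≠ 0 → ¬ IsCurveCusp β t) :
    ∃ c, ∀ t, deriv β t ≠ 0 → φ t - ψ t = c := by
  have hint : ∀ s, deriv β s ≠ 0 → ∃ n : ℤ, φ s - ψ s = n * (2 * Real.pi) := fun s hs => by
    have h1 := (hφ.angle s hs).symm.trans (hψ.angle s hs)
    obtain ⟨n, hn⟩ := Complex.exp_eq_exp_iff_exists_int.mp h1
    refine ⟨n, ?_⟩
    have h2 : (φ s : ℂ) = ψ s + n * (2 * Real.pi) := by
      apply mul_right_cancel₀ Complex.I_ne_zero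
      rw [hn]; ring
    have h3 : φ s = ψ s + n * (2 * Real.pi) := by exact_mod_cast h2
    rw [h3]; ring
  obtain ⟨c, hc⟩ := exists_eventually_nhdsNE_eq (f := fun s => φ s - ψ s) (by
    intro t
    -- At a cusp both angles jump by `π`, so their difference still has a two-sided limit.
    have hlim : ∃ b, Tendsto (fun s => φ s - ψ s) (𝓝[≠] t) (𝓝 b) := by
      by_cases ht : IsCurveCusp β t
      · obtain ⟨a, ha1, ha2⟩ := hφ.jump t ht
        obtain ⟨b, hb1, hb2⟩ := hψ.jump t ht
        refine ⟨a - b, ?_⟩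
        rw [← nhdsLT_sup_nhdsGT, tendsto_sup]
        refine ⟨ha1.sub hb1, ?_⟩
        have := ha2.sub hb2
        rwa [add_sub_add_right_eq_sub] at this
      · exact ⟨_, ((hφ.continuousAt t ht).sub (hψ.continuousAt t ht)).mono_left
          nhdsWithin_le_nhds⟩
    obtain ⟨b, hb⟩ := hlim
    exact eventually_eq_of_tendsto_of_int_multiple Real.two_pi_pos hb ((hiso t).mono hint))
  refine ⟨c, fun t ht => ?_⟩
  have h1 : Tendsto (fun s => φ s - ψ s) (𝓝[≠] t) (𝓝 (φ t - ψ t)) :=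
    ((hφ.continuousAt t (hreg t ht)).sub (hψ.continuousAt t (hreg t ht))).mono_left
      nhdsWithin_le_nhds
  exact tendsto_nhds_unique h1 (tendsto_const_nhds.congr' ((hc t).mono fun s hs => hs.symm))

theorem exp_add_pi_div_two_add_int_mul_pi (x : ℝ) (k : ℤ) :
    Complex.exp ((x + Real.pi / 2 + k * Real.pi : ℝ) * Complex.I) =
      ((-1 : ℝ) ^ k : ℝ) * (Complex.I * Complex.exp (x * Complex.I)) := by
  push_cast
  rw [add_mul, add_mul, Complex.exp_add, Complex.exp_add, Complex.exp_pi_div_two_mul_I,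
    mul_assoc (k : ℂ), Complex.exp_int_mul, Complex.exp_pi_mul_I]
  ring

theorem exists_eventually_sign {g : ℝ → ℝ} (hg : Continuous g) {t : ℝ}
    (h : ∀ᶠ s in 𝓝[≠] t, g s ≠ 0) : ∃ σ τ : ℝ, (σ = 1 ∨ σ = -1) ∧ (τ = 1 ∨ τ = -1) ∧
      (∀ᶠ s in 𝓝[<] t, Real.sign (g s) = σ) ∧ ∀ᶠ s in 𝓝[>] t, Real.sign (g s) = τ := by
  rw [eventually_nhdsNE_iff_left_right] at h
  obtain ⟨σ, hσ, hl⟩ : ∃ σ : ℝ, (σ = 1 ∨ σ = -1) ∧ ∀ᶠ s in 𝓝[<] t, Real.sign (g s) = σ :=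
    (eventually_pos_or_neg_left hg h.1).elim
      (fun h => ⟨1, by simp, h.mono fun s => Real.sign_of_pos⟩)
      (fun h => ⟨-1, by simp, h.mono fun s => Real.sign_of_neg⟩)
  obtain ⟨τ, hτ, hr⟩ : ∃ τ : ℝ, (τ = 1 ∨ τ = -1) ∧ ∀ᶠ s in 𝓝[>] t, Real.sign (g s) = τ :=
    (eventually_pos_or_neg_right hg h.2).elim
      (fun h => ⟨1, by simp, h.mono fun s => Real.sign_of_pos⟩)
      (fun h => ⟨-1, by simp, h.mono fun s => Real.sign_of_neg⟩)
  exact ⟨σ, τ, hσ, hτ, hl, hr⟩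

theorem eventually_sign_eq {g : ℝ → ℝ} (hg : Continuous g) {t : ℝ} (h : g t ≠ 0) :
    ∀ᶠ s in 𝓝 t, Real.sign (g s) = Real.sign (g t) := by
  rcases lt_or_gt_of_ne h with h | h
  · filter_upwards [(hg.tendsto t).eventually (gt_mem_nhds h)] with s hs
    rw [Real.sign_of_neg hs, Real.sign_of_neg h]
  · filter_upwards [(hg.tendsto t).eventually (lt_mem_nhds h)] with s hs
    rw [Real.sign_of_pos hs, Real.sign_of_pos h]

theorem not_isCurveCusp_of_ne_zero {β : ℝ → ℂ} {μ θ : ℝ → ℝ} (hθ : Continuous θ)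
    (hμ : Continuous μ)
    (hβ : ∀ t, deriv β t = μ t * (Complex.I * Complex.exp (θ t * Complex.I))) {t : ℝ}
    (ht : μ t ≠ 0) : ¬ IsCurveCusp β t := by
  have h := eventually_sign_eq hμ ht
  have hs : Real.sign (μ t) = 1 ∨ Real.sign (μ t) = -1 :=
    (Real.sign_apply_eq_of_ne_zero _ ht).symm
  rw [isCurveCusp_iff_sign hθ hβ hs (h.filter_mono nhdsWithin_le_nhds)
    (h.filter_mono nhdsWithin_le_nhds)]
  rcases hs with h | h <;> rw [h] <;> norm_num

/-- A curve of velocity `μ * I * exp (θ * I)`, where the zeros of `μ` are isolated, has a tangent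
angle which differs from `θ` by `π` times the number of cusps passed, up to a constant. The number
of its cusps in a period is even. -/
theorem exists_isTangentAngle {β : ℝ → ℂ} {μ θ : ℝ → ℝ} {L : ℝ} (hL : 0 < L)
    (hθ : Continuous θ) (hμ : Continuous μ) (hμper : Function.Periodic μ L)
    (hβ : ∀ t, deriv β t = μ t * (Complex.I * Complex.exp (θ t * Complex.I)))
    (hiso : ∀ t, ∀ᶠ s in 𝓝[≠] t, μ s ≠ 0) (hfin : {t ∈ Ico 0 L | IsCurveCusp β t}.Finite) :
    ∃ φ : ℝ → ℝ, IsTangentAngle β φ ∧ (∀ t, φ (t + L) - φ t =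
      θ (t + L) - θ t + {t ∈ Ico 0 L | IsCurveCusp β t}.ncard * Real.pi) ∧
      Even {t ∈ Ico 0 L | IsCurveCusp β t}.ncard := by
  have hcper : ∀ t, IsCurveCusp β (t + L) ↔ IsCurveCusp β t := by
    intro t
    obtain ⟨σ, τ, hσ, -, hl, hr⟩ := exists_eventually_sign hμ (hiso t)
    have hl' : ∀ᶠ s in 𝓝[<] (t + L), Real.sign (μ s) = σ := by
      rw [← map_add_right_nhdsLT]
      simpa only [eventually_map, hμper _] using hl
    have hr' : ∀ᶠ s in 𝓝[>] (t + L), Real.sign (μ s) = τ := by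
      rw [← map_add_right_nhdsGT]
      simpa only [eventually_map, hμper _] using hr
    rw [isCurveCusp_iff_sign hθ hβ hσ hl hr, isCurveCusp_iff_sign hθ hβ hσ hl' hr']
  obtain ⟨N, hNper, hNl, hNc, hNr⟩ :=
    exists_step_function (C := {t | IsCurveCusp β t}) hL hcper hfin
  have hne1 : (-1 : ℝ) ≠ 0 := by norm_num
  -- Both factors change sign exactly on passing a cusp, so their product is constant.
  obtain ⟨ε, hε⟩ := exists_eventually_nhdsNE_eq
    (f := fun t => (-1 : ℝ) ^ N t * Real.sign (μ t)) (by
      intro t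
      obtain ⟨σ, τ, hσ, hτ, hl, hr⟩ := exists_eventually_sign hμ (hiso t)
      have hiff := isCurveCusp_iff_sign hθ hβ hσ hl hr
      refine ⟨(-1 : ℝ) ^ N t * σ, ?_⟩
      rw [eventually_nhdsNE_iff_left_right]
      constructor
      · filter_upwards [hl, hNl t] with s h1 h2
        rw [h1, h2]
      · by_cases ht : IsCurveCusp β t
        · filter_upwards [hr, hNc t ht] with s h1 h2
          rw [h1, h2, hiff.mp ht, zpow_add₀ hne1]
          ring
        · filter_upwards [hr, hNr t ht] with s h1 h2
          have : τ = σ := by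
            rcases hσ with rfl | rfl <;> rcases hτ with rfl | rfl <;> simp_all
          rw [h1, h2, this])
  -- Since `N` is left-continuous, its value at a regular point can be compared with points just to
  -- the left.
  have hparity : ∀ t, μ t ≠ 0 → (-1 : ℝ) ^ N t * Real.sign (μ t) = ε := fun t ht => by
    obtain ⟨s, h1, h2, h3⟩ := ((eventually_nhdsNE_iff_left_right.mp (hε t)).1.and
      ((hNl t).and ((eventually_sign_eq hμ ht).filter_mono nhdsWithin_le_nhds))).exists
    rw [← h1, h2, h3]
  obtain ⟨t₀, ht₀⟩ := (hiso 0).exists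
  have hs₀ : Real.sign (μ t₀) = -1 ∨ Real.sign (μ t₀) = 1 := Real.sign_apply_eq_of_ne_zero _ ht₀
  have hN2 : ∀ k : ℤ, (-1 : ℝ) ^ k = 1 ∨ (-1 : ℝ) ^ k = -1 := fun k => by
    rcases Int.even_or_odd k with h | h
    · exact Or.inl h.neg_one_zpow
    · exact Or.inr h.neg_one_zpow
  obtain ⟨k, hk⟩ : ∃ k : ℤ, (-1 : ℝ) ^ k = ε := by
    have := hparity t₀ ht₀
    rcases hs₀ with h | h <;> rcases hN2 (N t₀) with h' | h' <;> rw [h, h'] at this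
    exacts [⟨1, by simp [← this]⟩, ⟨0, by simp [← this]⟩, ⟨0, by simp [← this]⟩,
      ⟨1, by simp [← this]⟩]
  have hsq : ∀ t, (-1 : ℝ) ^ N t * (-1 : ℝ) ^ N t = 1 := fun t => by
    rcases hN2 (N t) with h | h <;> rw [h] <;> norm_num
  -- The term `π / 2` accounts for the factor `I` in the frame, and `k` adjusts the parity so that
  -- `(-1) ^ (N t + k)` is the sign of `μ t`.
  refine ⟨fun t => θ t + Real.pi / 2 + ((N t + k : ℤ) : ℝ) * Real.pi, ⟨?_, ?_, ?_⟩, ?_, ?_⟩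
  · intro t ht
    have hμt : μ t ≠ 0 := fun h0 => ht (by rw [hβ, h0]; simp)
    have : (-1 : ℝ) ^ (N t + k) = Real.sign (μ t) := by
      rw [zpow_add₀ hne1, hk, ← hparity t hμt]
      linear_combination Real.sign (μ t) * hsq t
    rw [exp_add_pi_div_two_add_int_mul_pi, this, unitTangent_eq_sign hβ]
  · intro t ht
    have hN : ∀ᶠ s in 𝓝 t, N s = N t := eventually_nhds_of_left_right rfl (hNl t) (hNr t ht)
    have hc : ContinuousAt (fun s => θ s + Real.pi / 2 + ((N t + k : ℤ) : ℝ) * Real.pi) t :=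
      (by fun_prop : Continuous _).continuousAt
    refine hc.congr ?_
    filter_upwards [hN] with s hs
    rw [hs]
  · intro t ht
    have hc : ∀ x : ℝ, Tendsto (fun s => θ s + Real.pi / 2 + x) (𝓝 t)
        (𝓝 (θ t + Real.pi / 2 + x)) := fun x =>
      (by fun_prop : Continuous fun s => θ s + Real.pi / 2 + x).tendsto t
    refine ⟨θ t + Real.pi / 2 + ((N t + k : ℤ) : ℝ) * Real.pi, ?_, ?_⟩
    · refine ((hc _).mono_left nhdsWithin_le_nhds).congr' ?_
      filter_upwards [hNl t] with s hs
      rw [hs]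
    · rw [add_assoc (θ t + Real.pi / 2)]
      refine ((hc _).mono_left nhdsWithin_le_nhds).congr' ?_
      filter_upwards [hNc t ht] with s hs
      rw [hs]
      push_cast
      ring
  · intro t
    simp only [hNper, mem_ofPred_eq]
    push_cast
    ring
  -- Over one period `μ` recovers its sign while `N` grows by the number of cusps; constancy of the
  -- product forces that number to be even.
  · have h1 := hparity t₀ ht₀
    have h2 := hparity (t₀ + L) (by rw [hμper]; exact ht₀)
    rw [hμper, hNper, zpow_add₀ hne1, ← h1, mul_right_comm] at h2
    have h3 : (-1 : ℝ) ^ N t₀ * Real.sign (μ t₀) ≠ 0 :=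
      mul_ne_zero (zpow_ne_zero _ hne1) (by rcases hs₀ with h | h <;> rw [h] <;> norm_num)
    have h4 := mul_left_cancel₀ h3 (h2.trans (mul_one _).symm)
    rw [zpow_natCast] at h4
    exact (neg_one_pow_eq_one_iff_even (by norm_num)).mp h4

/-! ### The evolute of an oval -/

theorem Real.sign_neg_div_sq (a : ℝ) {b : ℝ} (hb : b ≠ 0) :
    Real.sign (-a / b ^ 2) = -Real.sign a := by
  have hb2 : 0 < b ^ 2 := by positivity
  rcases lt_trichotomy a 0 with h | h | h
  · rw [Real.sign_of_neg h, Real.sign_of_pos (div_pos (neg_pos.mpr h) hb2), neg_neg]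
  · simp [h]
  · rw [Real.sign_of_pos h, Real.sign_of_neg (div_neg_of_neg_of_pos (neg_lt_zero.mpr h) hb2)]

/-- The tangent angle of an oval of negative curvature decreases by `2 * π` in each circuit. -/
theorem IsPlaneOval.angle_period_sub {γ : ℝ → ℂ} {L : ℝ} (hγ : IsPlaneOval γ L) {θ : ℝ → ℝ}
    (hθ : ∀ t, deriv γ t = ‖deriv γ t‖ * Complex.exp (θ t * Complex.I)) (hc : Continuous θ)
    (hanti : StrictAnti θ) (t : ℝ) : θ (t + L) - θ t = -(2 * Real.pi) := by
  have h1 := hγ.smooth.deriv_of_infty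
  obtain ⟨a, ha⟩ := exists_abs_angle_period_sub_eq_two_pi hγ.period_pos
    (hγ.smooth.differentiable (by simp)) h1.continuous hγ.closed hγ.simple hγ.regular hc hθ
  have hexp : ∀ s, Complex.exp (θ s * Complex.I) = deriv γ s / ‖deriv γ s‖ := fun s => by
    have hn : (‖deriv γ s‖ : ℂ) ≠ 0 := by simpa using hγ.regular s
    rw [eq_div_iff hn, mul_comm]; exact (hθ s).symm
  -- The increment over a period is continuous and a multiple of `2π`, hence independent of the
  -- starting point, so Hopf's theorem at one point suffices.
  have hconst : θ (t + L) - θ t = θ (a + L) - θ a := by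
    refine eq_of_exp_mul_I_eq (f := fun s => θ (s + L) - θ s) (by fun_prop) (z := 1)
      (fun s => ?_) _ _
    push_cast
    rw [sub_mul, Complex.exp_sub, hexp, hexp, hγ.closed.deriv_periodic, div_self]
    exact div_ne_zero (hγ.regular s) (by simpa using hγ.regular s)
  have hlt : θ (a + L) - θ a < 0 := sub_neg.mpr (hanti (by linarith [hγ.period_pos]))
  rw [hconst, ← ha, abs_of_neg hlt, neg_neg]

/-- Let `γ` be a plane oval of negative signed curvature whose curvature has finitely many
critical points, and let `β` be its evolute. Then `β` carries the standard orientation, its cusps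
correspond to the vertices of `γ`, their number `n` is finite, and the rotation index `i` of
`β` exists, is unique, and equals `(n - 2) / 2`. -/
theorem theorem1 (γ β : ℝ → ℂ) (L : ℝ) (hγ : IsPlaneOval γ L)
    (hneg : ∀ t, signedCurvature γ t < 0)
    (hfin : {t ∈ Ico 0 L | deriv (signedCurvature γ) t = 0}.Finite)
    (hβ : IsEvolute γ β) :
    IsStandardlyOriented β ∧
    (∀ t, IsCurveCusp β t ↔ IsVertex γ t) ∧
    {t ∈ Ico 0 L | IsCurveCusp β t}.Finite ∧
    ∃ i : ℤ, (∀ j : ℤ, HasRotationIndex β L j ↔ j = i) ∧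
      (i : ℝ) = (({t ∈ Ico 0 L | IsCurveCusp β t}.ncard : ℝ) - 2) / 2 := by
  have hL := hγ.period_pos
  have hκ := hγ.strictlyConvex
  obtain ⟨θ, hθ, hθ'⟩ := exists_tangent_angle hγ.smooth hγ.regular
  have hθc : Continuous θ := continuous_iff_continuousAt.mpr fun t => (hθ' t).continuousAt
  have hanti : StrictAnti θ := strictAnti_of_deriv_neg fun t => by
    rw [(hθ' t).deriv]
    exact mul_neg_of_neg_of_pos (hneg t) (norm_pos_iff.mpr (hγ.regular t))
  have hκs := contDiff_signedCurvature hγ.smooth hγ.regular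
  have hκ'c : Continuous (deriv (signedCurvature γ)) := hκs.continuous_deriv (by simp)
  have hκper := signedCurvature_periodic hγ.closed
  have hκ'per : Function.Periodic (deriv (signedCurvature γ)) L := fun t => by
    rw [← deriv_comp_add_const]
    congr 1
    exact funext hκper
  have hκiso := eventually_ne_zero_of_finite_zeros hL hκ'per hfin
  let μ : ℝ → ℝ := fun t => -deriv (signedCurvature γ) t / signedCurvature γ t ^ 2
  have hβ' : ∀ t, deriv β t = μ t * (Complex.I * Complex.exp (θ t * Complex.I)) :=
    hβ.deriv_eq hγ.smooth hγ.regular hκ hθ hθ'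
  have hμc : Continuous μ := hκ'c.neg.div (hκs.continuous.pow 2) fun t => pow_ne_zero _ (hκ t)
  have hμper : Function.Periodic μ L := fun t => by simp only [μ, hκ'per t, hκper t]
  have hμ0 : ∀ t, deriv (signedCurvature γ) t ≠ 0 → μ t ≠ 0 := fun t ht =>
    div_ne_zero (neg_ne_zero.mpr ht) (pow_ne_zero _ (hκ t))
  have hμiso : ∀ t, ∀ᶠ s in 𝓝[≠] t, μ s ≠ 0 := fun t => (hκiso t).mono hμ0
  have hβreg : ∀ t, deriv β t ≠ 0 ↔ μ t ≠ 0 := fun t => by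
    simp [hβ', Complex.exp_ne_zero]
  have hβs := hβ.contDiff hγ.smooth hγ.regular hκ
  have hβper := hβ.periodic hγ.smooth hγ.regular hκ hγ.closed
  have hcusp : ∀ t, IsCurveCusp β t ↔ IsVertex γ t := fun t => by
    obtain ⟨σ, τ, hσ, -, hl, hr, hiff⟩ := exists_sign_deriv hκs.continuous hκ'c (hκiso t)
    -- Passing from `κ'` to `μ` negates the signs on both sides, so whether they differ is
    -- unaffected.
    have hl' : ∀ᶠ s in 𝓝[<] t, Real.sign (μ s) = -σ :=
      hl.mono fun s hs => by rw [← hs]; exact Real.sign_neg_div_sq _ (hκ s)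
    have hr' : ∀ᶠ s in 𝓝[>] t, Real.sign (μ s) = -τ :=
      hr.mono fun s hs => by rw [← hs]; exact Real.sign_neg_div_sq _ (hκ s)
    rw [isCurveCusp_iff_sign hθc hβ' (by rcases hσ with rfl | rfl <;> simp) hl' hr', IsVertex, hiff,
      neg_inj]
  have hcfin : {t ∈ Ico 0 L | IsCurveCusp β t}.Finite :=
    hfin.subset fun t ht => ⟨ht.1, ((hcusp t).mp ht.2).deriv_eq_zero⟩
  have hnc : ∀ t, deriv β t ≠ 0 → ¬ IsCurveCusp β t := fun t ht =>
    not_isCurveCusp_of_ne_zero hθc hμc hβ' ((hβreg t).mp ht)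
  have hβiso : ∀ t, ∀ᶠ s in 𝓝[≠] t, deriv β s ≠ 0 := fun t =>
    (hμiso t).mono fun s => (hβreg s).mpr
  refine ⟨isStandardlyOriented_of_angle (hβs.differentiable (by simp)) hμc hθc hanti hβ', hcusp,
    hcfin, ?_⟩
  obtain ⟨φ, hφ, hφL, m, hm⟩ := exists_isTangentAngle hL hθc hμc hμper hβ' hμiso hcfin
  -- With `n = m + m` cusps the total turning is `-2π + 2mπ`.
  have hturn : ∀ t, φ (t + L) - φ t = 2 * Real.pi * ((m : ℤ) - 1 : ℤ) := fun t => by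
    rw [hφL, hγ.angle_period_sub hθ hθc hanti, hm]
    push_cast
    ring
  refine ⟨(m : ℤ) - 1, fun j => ⟨?_, ?_⟩, ?_⟩
  · rintro ⟨-, -, -, -, ψ, hψ, hψL⟩
    obtain ⟨c, hc⟩ := hφ.exists_sub_eq hψ hβiso hnc
    obtain ⟨t, ht⟩ := (hβiso 0).exists
    have h1 := hc t ht
    have h2 := hc (t + L) (by rwa [hβper.deriv_periodic])
    have h3 : 2 * Real.pi * (j : ℝ) = 2 * Real.pi * ((m : ℤ) - 1 : ℤ) := by
      rw [← hψL t ht, ← hturn t]; linarith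
    exact_mod_cast mul_left_cancel₀ Real.two_pi_pos.ne' h3
  · rintro rfl
    exact ⟨hL, hβs, hβper, hβiso, φ, hφ, fun t _ => hturn t⟩
  · rw [hm]
    push_cast
    ring
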